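/- For $t\in\mathbb{R}$ let $\|t\|$ denote the distance from $t$ to the nearest integer. For real numbers $i,j>0$ with $i+j=1$ let $$\mathrm{Bad}(i,j)=\Big\{(x_1,x_2)\in[0,1)^2:\ \inf_{q\in\mathbb{Z}\setminus\{0\}}\max\big\{|q|^i\|qx_1\|,\ |q|^j\|qx_2\|\big\}>0\Big\},$$ and for $\mathbf{x}=(x_1,x_2)$ let $$\mathrm{Bad}_{\mathbf{x}}(i,j)=\Big\{(\alpha_1,\alpha_2)\in[0,1)^2:\ \inf_{q\in\mathbb{Z}\setminus\{0\}}\max\big\{|q|^i\|qx_1-\alpha_1\|,\ |q|^j\|qx_2-\alpha_2\|\big\}>0\Big\}.$$ Recall Schmidt's $(\alpha,\beta)$-game on the Euclidean plane $\mathbb{R}^2$ ($0<\alpha,\beta<1$): Bob chooses a closed ball $B_0$ of arbitrary radius $\rho>0$; then, alternately for $n=0,1,2,\dots$, Alice chooses a closed ball $A_n\subseteq B_n$ whose radius is $\alpha$ times that of $B_n$, and Bob chooses a closed ball $B_{n+1}\subseteq A_n$ whose radius is $\beta$ times that of $A_n$. A set $S\subseteq\mathbb{R}^2$ is $\alpha$-winning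 if for every $\beta\in(0,1)$ Alice has a strategy which guarantees that the unique point of $\bigcap_n B_n$ lies in $S$. **Corollary.** For any real numbers $i,j>0$ with $i+j=1$ and any $\mathbf{x}\in\mathrm{Bad}(i,j)$, the set $\mathrm{Bad}_{\mathbf{x}}(i,j)$ is $1/2$-winning. Here $[0,1)^2$ is identified with the torus $\mathbb{R}^2/\mathbb{Z}^2$ as usual; that is, the $\mathbb{Z}^2$-periodic set $\mathrm{Bad}_{\mathbf{x}}(i,j)+\mathbb{Z}^2\subseteq\mathbb{R}^2$ is $1/2$-winning. -/

import Mathlib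

/-- The distance from a real number to the nearest integer. -/
noncomputable def distNearestInt (t : ℝ) : ℝ := |t - round t|

/-- The set `Bad(i, j)` of all `(x₁, x₂) ∈ [0,1)²` such that
`inf_{q ≠ 0} max (|q|^i ‖q x₁‖, |q|^j ‖q x₂‖) > 0`. -/
def Bad (i j : ℝ) : Set (EuclideanSpace ℝ (Fin 2)) :=
  {x | (∀ k, x k ∈ Set.Ico (0 : ℝ) 1) ∧
    0 < ⨅ q : {q : ℤ // q ≠ 0},
      max (|(q.1 : ℝ)| ^ i * distNearestInt ((q.1 : ℝ) * x 0))
        (|(q.1 : ℝ)| ^ j * distNearestInt ((q.1 : ℝ) * x 1))}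

/-- The set `Bad_x(i, j)` of all `(a₁, a₂) ∈ [0,1)²` such that
`inf_{q ≠ 0} max (|q|^i ‖q x₁ - a₁‖, |q|^j ‖q x₂ - a₂‖) > 0`. -/
def TwistedBad (x : EuclideanSpace ℝ (Fin 2)) (i j : ℝ) : Set (EuclideanSpace ℝ (Fin 2)) :=
  {a | (∀ k, a k ∈ Set.Ico (0 : ℝ) 1) ∧
    0 < ⨅ q : {q : ℤ // q ≠ 0},
      max (|(q.1 : ℝ)| ^ i * distNearestInt ((q.1 : ℝ) * x 0 - a 0))
        (|(q.1 : ℝ)| ^ j * distNearestInt ((q.1 : ℝ) * x 1 - a 1))}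

/-- For `S ⊆ [0,1)²`, seen as a subset of the torus `ℝ² / ℤ²`, the `ℤ²`-periodic set
`S + ℤ² ⊆ ℝ²` of all points whose reduction modulo one lies in `S`. -/
noncomputable def periodicExtension (S : Set (EuclideanSpace ℝ (Fin 2))) :
    Set (EuclideanSpace ℝ (Fin 2)) :=
  {a | !₂[Int.fract (a 0), Int.fract (a 1)] ∈ S}

/-- `S` is `(α, β)`-winning for Schmidt's game. Bob opens with a closed ball of centre `b 0` and
any radius `ρ > 0`; then Alice chooses a closed ball inside Bob's last ball with `α` times its
radius, Bob a closed ball inside Alice's last ball with `β` times its radius, and so on. Thus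
Bob's `n`-th ball has radius `(αβ)ⁿ ρ` and Alice's reply to it has radius `α (αβ)ⁿ ρ`.
A strategy `F` for Alice computes the centre of her next ball from `ρ` and the list of the
centres that Bob has chosen so far. It wins if, whenever Bob obeys the rules, Alice does so too
and the unique common point of all the balls lies in `S`. -/
def IsSchmidtWinningPair {X : Type*} [MetricSpace X] (α β : ℝ) (S : Set X) : Prop :=
  ∃ F : ℝ → List X → X, ∀ ρ : ℝ, 0 < ρ → ∀ a b : ℕ → X,
    (∀ n, a n = F ρ ((List.range (n + 1)).map b)) →
    (∀ n, Metric.closedBall (b (n + 1)) ((α * β) ^ (n + 1) * ρ) ⊆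
      Metric.closedBall (a n) (α * ((α * β) ^ n * ρ))) →
    (∀ n, Metric.closedBall (a n) (α * ((α * β) ^ n * ρ)) ⊆
      Metric.closedBall (b n) ((α * β) ^ n * ρ)) ∧
    ∃ s ∈ S, ⋂ n, Metric.closedBall (b n) ((α * β) ^ n * ρ) = {s}

/-- `S` is `α`-winning: it is `(α, β)`-winning for every `β ∈ (0, 1)`. -/
def IsSchmidtWinning {X : Type*} [MetricSpace X] (α : ℝ) (S : Set X) : Prop :=
  ∀ β : ℝ, 0 < β → β < 1 → IsSchmidtWinningPair α β S

/-! The proof passes to integer linear forms `u = (u₁, u₂)`. Transference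
(`IsBadConstant.linearForm`) shows that no nonzero form in the box `|u₁| ≤ a T ^ i`, `|u₂| ≤ a T ^
j` is within `a ^ 2 / T` of an integer at `x`. Dirichlet's theorem, with the first side of the box
lengthened, does give such a form, so its `|u₁|` must exceed `a T ^ i`. When `j ≤ i` this makes
`‖u‖` comparable to `T ^ i`, and suitable scales `T = R ^ k` yield forms `u k` of geometrically
growing size.

If `u k · y` stays `ε`-away from the integers for every `k`, then `y` is in the twisted set
(`exists_pos_le_max_of_linearForms`): modulo integers, `u · y = q (u · x) - u · (q x - y)`, and at a
scale comparable to `|q|` the first term is too small to account for `ε`.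

Alice can force this property (`isSchmidtWinningPair_half_of_lacunary`). She devotes two rounds to
each form, both times moving as far as possible in the direction that takes the form away from its
nearest integer. -/

theorem distNearestInt_nonneg (t : ℝ) : 0 ≤ distNearestInt t := abs_nonneg _

theorem distNearestInt_le (t : ℝ) (n : ℤ) : distNearestInt t ≤ |t - n| := round_le t n

theorem distNearestInt_add_intCast (t : ℝ) (n : ℤ) :
    distNearestInt (t + n) = distNearestInt t := by
  simp [distNearestInt]

theorem distNearestInt_le_abs_mul (q : ℤ) (t : ℝ) :
    distNearestInt (q * t) ≤ |(q : ℝ)| * distNearestInt t := by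
  have h := distNearestInt_le (q * t) (q * round t)
  rw [distNearestInt.eq_def t, ← abs_mul, mul_sub]
  simpa using h

/-! ### Transference from simultaneous approximation to linear forms. -/

/-- If a linear form with coefficients `u₁, u₂` is too close to an integer at `(x₁, x₂)`, then
`(x₁, x₂)` has a good simultaneous approximation with denominator at most `T`. -/
theorem exists_simultaneous_approx {i j a T x₁ x₂ : ℝ} {u₁ u₂ : ℤ} (hi : 0 < i)
    (hij : i + j = 1) (ha : 0 < a) (ha1 : a ≤ 1) (hT : 1 ≤ T)
    (h₁ : |(u₁ : ℝ)| ≤ a * T ^ i) (h₂ : |(u₂ : ℝ)| = a * T ^ j)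
    (h : distNearestInt (u₁ * x₁ + u₂ * x₂) < a ^ 2 / T) :
    ∃ d : ℤ, 1 ≤ d ∧ (d : ℝ) ≤ T ∧ distNearestInt (d * x₁) ≤ 4 * a * T ^ (-i) ∧
      distNearestInt (d * x₂) ≤ 4 * a * T ^ (-j) := by
  have hT0 : 0 < T := by linarith
  have hTi : 1 ≤ T ^ i := Real.one_le_rpow hT hi.le
  have hTi0 : 0 < T ^ i := by positivity
  have hTj0 : 0 < T ^ j := by positivity
  have hu₂ : u₂ ≠ 0 := by
    rintro rfl
    have : 0 < a * T ^ j := by positivity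
    rw [← h₂] at this
    simp at this
  have hTT : T ^ i * T ^ j = T := by rw [← Real.rpow_add hT0, hij, Real.rpow_one]
  set M : ℤ := ⌊T ^ i / a⌋ with hM
  have hTa : 1 ≤ T ^ i / a := by
    rw [le_div_iff₀ ha]; linarith
  have hM1 : 1 ≤ M := Int.le_floor.2 (by simpa using hTa)
  have hM1' : (1 : ℝ) ≤ M := by exact_mod_cast hM1
  have hMle : (M : ℝ) ≤ T ^ i / a := Int.floor_le _
  have hMlt : T ^ i / a < M + 1 := Int.lt_floor_add_one _
  have hMinv : 1 / (M : ℝ) ≤ 2 * a * T ^ (-i) := by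
    rw [Real.rpow_neg hT0.le, div_le_iff₀ (by linarith)]
    have : T ^ i / a ≤ 2 * M := by linarith
    rw [div_le_iff₀ ha] at this
    calc (1 : ℝ) = T ^ i * (T ^ i)⁻¹ := by field_simp
      _ ≤ (2 * M * a) * (T ^ i)⁻¹ := by gcongr
      _ = _ := by ring
  set y : ℤ → ℝ := fun q => u₁ * Int.fract (q * x₁) + u₂ * Int.fract (q * x₂) with hy
  -- The pigeonholes are `M` intervals for the first fractional part and the residues mod `u₂` of
  -- the integer nearest to `y q`. Their number is at most `(T ^ i / a) * (a * T ^ j) = T`, fewer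
  -- than the `⌊T⌋ + 1` values of `q`.
  let f : ℤ → ℤ × ℤ := fun q => (⌊M * Int.fract (q * x₁)⌋, round (y q) % |u₂|)
  have hδ : ∀ q : ℤ, 0 ≤ q → (q : ℝ) ≤ T → |y q - round (y q)| ≤ a ^ 2 := by
    intro q hq hqT
    have e : y q = (q : ℝ) * (u₁ * x₁ + u₂ * x₂)
        + ((-(u₁ * ⌊q * x₁⌋) - u₂ * ⌊q * x₂⌋ : ℤ) : ℝ) := by
      simp only [hy, Int.fract]; push_cast; ring
    have hq' : (0 : ℝ) ≤ q := by exact_mod_cast hq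
    calc |y q - round (y q)| = distNearestInt (y q) := rfl
      _ = distNearestInt ((q : ℝ) * (u₁ * x₁ + u₂ * x₂)) := by
        rw [e, distNearestInt_add_intCast]
      _ ≤ |(q : ℝ)| * distNearestInt (u₁ * x₁ + u₂ * x₂) := distNearestInt_le_abs_mul _ _
      _ ≤ T * (a ^ 2 / T) := by rw [abs_of_nonneg hq']; gcongr; exact distNearestInt_nonneg _
      _ = a ^ 2 := by field_simp
  have hmaps : ∀ q ∈ Finset.Icc 0 ⌊T⌋, f q ∈ Finset.Ico 0 M ×ˢ Finset.Ico 0 |u₂| := by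
    intro q _
    have hf0 := Int.fract_nonneg ((q : ℝ) * x₁)
    have hf1 := Int.fract_lt_one ((q : ℝ) * x₁)
    simp only [f, Finset.mem_product, Finset.mem_Ico]
    refine ⟨⟨Int.floor_nonneg.2 (by positivity), Int.floor_lt.2 ?_⟩,
      Int.emod_nonneg _ (abs_ne_zero.2 hu₂), Int.emod_lt_of_pos _ (abs_pos.2 hu₂)⟩
    nlinarith
  have hcard : (Finset.Ico 0 M ×ˢ Finset.Ico 0 |u₂|).card < (Finset.Icc 0 ⌊T⌋).card := by
    rw [Finset.card_product, Int.card_Ico, Int.card_Ico, Int.card_Icc]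
    have h3 : (M : ℝ) * |(u₂ : ℝ)| ≤ T := by
      calc (M : ℝ) * |(u₂ : ℝ)| ≤ T ^ i / a * (a * T ^ j) := by rw [h₂]; gcongr
        _ = T ^ i * T ^ j := by field_simp
        _ = T := hTT
    have h4 : M * |u₂| ≤ ⌊T⌋ := Int.le_floor.2 (by push_cast; exact h3)
    zify
    rw [Int.toNat_of_nonneg (by lia), Int.toNat_of_nonneg (by simp),
      Int.toNat_of_nonneg (by have := Int.floor_nonneg.2 hT0.le; lia)]
    linarith
  obtain ⟨p, hp, q, hq, hne, hf⟩ := Finset.exists_ne_map_eq_of_card_lt_of_maps_to hcard hmaps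
  wlog hpq : p < q generalizing p q
  · exact this q hq p hp hne.symm hf.symm (lt_of_le_of_ne (not_lt.1 hpq) hne.symm)
  simp only [Finset.mem_Icc] at hp hq
  have hpT : (p : ℝ) ≤ T := Int.le_floor.1 hp.2
  have hqT : (q : ℝ) ≤ T := Int.le_floor.1 hq.2
  have hδp := hδ p hp.1 hpT
  have hδq := hδ q hq.1 hqT
  simp only [f, Prod.mk.injEq] at hf
  have hp0 : (0 : ℝ) ≤ p := by exact_mod_cast hp.1
  obtain ⟨hf1, hf2⟩ := hf
  have hΔ : |Int.fract ((q : ℝ) * x₁) - Int.fract (p * x₁)| ≤ 2 * a * T ^ (-i) := by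
    refine le_trans ?_ hMinv
    have := Int.abs_sub_lt_one_of_floor_eq_floor hf1.symm
    rw [← mul_sub, abs_mul, abs_of_nonneg (by linarith : (0 : ℝ) ≤ M)] at this
    rw [le_div_iff₀ (by linarith)]
    linarith
  -- Equal residues let the difference of the nearest integers be absorbed, after division by `u₂`,
  -- into the integer approximating `(q - p) * x₂`.
  obtain ⟨l, hl⟩ : u₂ ∣ round (y q) - round (y p) :=
    (abs_dvd _ _).1 (Int.ModEq.dvd hf2)
  have hl' : (round (y q) : ℝ) - round (y p) = u₂ * l := by exact_mod_cast hl
  refine ⟨q - p, by lia, by push_cast; linarith, ?_, ?_⟩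
  · refine (distNearestInt_le _ (⌊q * x₁⌋ - ⌊p * x₁⌋)).trans ?_
    have e : ((q - p : ℤ) : ℝ) * x₁ - ((⌊q * x₁⌋ - ⌊p * x₁⌋ : ℤ) : ℝ) =
        Int.fract ((q : ℝ) * x₁) - Int.fract (p * x₁) := by
      simp only [Int.fract]; push_cast; ring
    rw [e]
    refine hΔ.trans ?_
    have : 0 < T ^ (-i) := by positivity
    nlinarith
  · refine (distNearestInt_le _ (⌊q * x₂⌋ - ⌊p * x₂⌋ + l)).trans ?_
    set D := ((q - p : ℤ) : ℝ) * x₂ - ((⌊q * x₂⌋ - ⌊p * x₂⌋ + l : ℤ) : ℝ) with hD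
    have e : (u₂ : ℝ) * D = (y q - round (y q)) - (y p - round (y p))
        - u₁ * (Int.fract ((q : ℝ) * x₁) - Int.fract (p * x₁)) := by
      have : (u₂ : ℝ) * D = u₂ * (Int.fract ((q : ℝ) * x₂) - Int.fract (p * x₂)) - u₂ * l := by
        simp only [hD, Int.fract]; push_cast; ring
      rw [this, ← hl']; simp only [hy]; ring
    have h5 : |(u₁ : ℝ) * (Int.fract ((q : ℝ) * x₁) - Int.fract (p * x₁))| ≤ 2 * a ^ 2 := by
      rw [abs_mul]
      calc _ ≤ a * T ^ i * (2 * a * T ^ (-i)) := by gcongr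
        _ = 2 * a ^ 2 * (T ^ i * T ^ (-i)) := by ring
        _ = 2 * a ^ 2 := by rw [← Real.rpow_add hT0]; simp
    -- The two rounding errors contribute `a ^ 2` each and the `u₁` term `2 * a ^ 2`.
    have h6 : a * T ^ j * |D| ≤ 4 * a ^ 2 := by
      rw [← h₂, ← abs_mul, e]
      have := abs_sub (y q - round (y q) - (y p - round (y p)))
        (u₁ * (Int.fract ((q : ℝ) * x₁) - Int.fract (p * x₁)))
      have := abs_sub (y q - round (y q)) (y p - round (y p))
      linarith
    rw [Real.rpow_neg hT0.le, ← div_eq_mul_inv, le_div_iff₀ hTj0]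
    have h7 : a * (|D| * T ^ j) ≤ a * (4 * a) := by linarith
    exact le_of_mul_le_mul_left h7 ha

/-- A lower bound `c` for the quantity whose positivity defines `Bad i j`. -/
def IsBadConstant (c i j x₁ x₂ : ℝ) : Prop :=
  ∀ q : ℤ, q ≠ 0 → c ≤ max (|(q : ℝ)| ^ i * distNearestInt (q * x₁))
    (|(q : ℝ)| ^ j * distNearestInt (q * x₂))

theorem IsBadConstant.swap {c i j x₁ x₂ : ℝ} (h : IsBadConstant c i j x₁ x₂) :
    IsBadConstant c j i x₂ x₁ := fun q hq => by rw [max_comm]; exact h q hq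

/-- A smaller value would produce a denominator `d ≤ T` for which both weighted distances are at
most `4 * a`, below the constant `8 * a`. -/
theorem IsBadConstant.linearForm_of_eq {i j a T x₁ x₂ : ℝ} {u₁ u₂ : ℤ}
    (hx : IsBadConstant (8 * a) i j x₁ x₂) (hi : 0 < i) (hj : 0 < j)
    (hij : i + j = 1) (ha : 0 < a) (ha1 : a ≤ 1) (hT : 1 ≤ T)
    (h₁ : |(u₁ : ℝ)| ≤ a * T ^ i) (h₂ : |(u₂ : ℝ)| = a * T ^ j) :
    a ^ 2 / T ≤ distNearestInt (u₁ * x₁ + u₂ * x₂) := by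
  by_contra! h
  obtain ⟨d, hd1, hdT, hd₁, hd₂⟩ := exists_simultaneous_approx hi hij ha ha1 hT h₁ h₂ h
  have hd1' : (1 : ℝ) ≤ d := by exact_mod_cast hd1
  have key : ∀ e y : ℝ, 0 < e → distNearestInt (d * y) ≤ 4 * a * T ^ (-e) →
      |(d : ℝ)| ^ e * distNearestInt (d * y) ≤ 4 * a := by
    intro e y he hy
    rw [abs_of_nonneg (by linarith)]
    calc (d : ℝ) ^ e * distNearestInt (d * y) ≤ T ^ e * (4 * a * T ^ (-e)) := by
          gcongr
          exact distNearestInt_nonneg _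
      _ = 4 * a * (T ^ e * T ^ (-e)) := by ring
      _ = 4 * a := by rw [← Real.rpow_add (by linarith)]; simp
  have := hx d (by lia)
  have := this.trans (max_le (key i x₁ hi hd₁) (key j x₂ hj hd₂))
  linarith

/-- Transference: badly approximable points are badly approximable for the dual linear form. -/
theorem IsBadConstant.linearForm {i j a T x₁ x₂ : ℝ} {u₁ u₂ : ℤ}
    (hx : IsBadConstant (8 * a) i j x₁ x₂) (hi : 0 < i) (hj : 0 < j)
    (hij : i + j = 1) (ha : 0 < a) (ha1 : a ≤ 1) (hT : 1 ≤ T) (hu : u₁ ≠ 0 ∨ u₂ ≠ 0)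
    (h₁ : |(u₁ : ℝ)| ≤ a * T ^ i) (h₂ : |(u₂ : ℝ)| ≤ a * T ^ j) :
    a ^ 2 / T ≤ distNearestInt (u₁ * x₁ + u₂ * x₂) := by
  have hT0 : 0 < T := by linarith
  have key : ∀ (e : ℝ) (v : ℤ), 0 < e → a * ((|(v : ℝ)| / a) ^ e⁻¹) ^ e = |(v : ℝ)| := by
    intro e v he
    rw [← Real.rpow_mul (by positivity), inv_mul_cancel₀ he.ne', Real.rpow_one]
    field_simp
  have le : ∀ (e : ℝ) (v : ℤ), 0 < e → |(v : ℝ)| ≤ a * T ^ e → (|(v : ℝ)| / a) ^ e⁻¹ ≤ T := by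
    intro e v he hv
    rw [Real.rpow_inv_le_iff_of_pos (by positivity) hT0.le he, div_le_iff₀ ha]
    linarith
  have one_le : ∀ (e : ℝ) (v : ℤ), 0 < e → v ≠ 0 → 1 ≤ (|(v : ℝ)| / a) ^ e⁻¹ := by
    intro e v he hv
    have : (1 : ℝ) ≤ |(v : ℝ)| := by exact_mod_cast Int.one_le_abs hv
    exact Real.one_le_rpow ((one_le_div ha).2 (by linarith)) (by positivity)
  have hmax : 1 ≤ max ((|(u₁ : ℝ)| / a) ^ i⁻¹) ((|(u₂ : ℝ)| / a) ^ j⁻¹) :=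
    hu.elim (fun h => le_max_of_le_left (one_le _ _ hi h))
      fun h => le_max_of_le_right (one_le _ _ hj h)
  -- These are the scales at which each coefficient bound becomes an equality. The larger one is the
  -- least `T` admissible for both bounds. It is at least 1 because the form is nonzero, and
  -- shrinking `T` to it only strengthens the conclusion.
  set T₁ := (|(u₁ : ℝ)| / a) ^ i⁻¹ with hT₁
  set T₂ := (|(u₂ : ℝ)| / a) ^ j⁻¹ with hT₂
  have h0₁ : 0 ≤ T₁ := by positivity
  have h0₂ : 0 ≤ T₂ := by positivity
  rcases le_total T₁ T₂ with h | h
  · rw [max_eq_right h] at hmax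
    have := hx.linearForm_of_eq (u₁ := u₁) (u₂ := u₂) hi hj hij ha ha1 hmax
      (by rw [← key i u₁ hi]; gcongr) (key j u₂ hj).symm
    refine le_trans ?_ this
    gcongr
    exact le j u₂ hj h₂
  · rw [max_eq_left h] at hmax
    have := hx.swap.linearForm_of_eq (u₁ := u₂) (u₂ := u₁) hj hi (by linarith) ha ha1 hmax
      (by rw [← key j u₂ hj]; gcongr) (key i u₁ hi).symm
    rw [add_comm]
    refine le_trans ?_ this
    gcongr
    exact le i u₁ hi h₁

/-! ### Small linear forms at every scale. -/

/-- Dirichlet's theorem for one linear form in two variables, with weights. -/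
theorem exists_linearForm_lt {i j a T : ℝ} (x₁ x₂ : ℝ)
    (hij : i + j = 1) (ha : 0 < a) (ha1 : a ≤ 1) (hT : 1 ≤ T) :
    ∃ u₁ u₂ : ℤ, (u₁ ≠ 0 ∨ u₂ ≠ 0) ∧ |(u₁ : ℝ)| ≤ 2 / a ^ 3 * T ^ i ∧
      |(u₂ : ℝ)| ≤ a * T ^ j ∧ distNearestInt (u₁ * x₁ + u₂ * x₂) < a ^ 2 / T := by
  have hT0 : 0 < T := by linarith
  have hTT : T ^ i * T ^ j = T := by rw [← Real.rpow_add hT0, hij, Real.rpow_one]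
  have ha2 : a ^ 2 ≤ 1 := pow_le_one₀ ha.le ha1
  set M : ℤ := ⌈T / a ^ 2⌉ with hM
  have hTM : T / a ^ 2 ≤ M := Int.le_ceil _
  have h1T : 1 ≤ T / a ^ 2 := by rw [le_div_iff₀ (by positivity)]; linarith
  have hM0 : (0 : ℝ) < M := by linarith
  have hMle : (M : ℝ) ≤ 2 * T / a ^ 2 := by
    have := Int.ceil_lt_add_one (T / a ^ 2)
    rw [mul_div_assoc]
    linarith
  set N₁ := ⌊2 / a ^ 3 * T ^ i⌋ with hN₁
  set N₂ := ⌊a * T ^ j⌋ with hN₂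
  have hN₁0 : 0 ≤ N₁ := Int.floor_nonneg.2 (by positivity)
  have hN₂0 : 0 ≤ N₂ := Int.floor_nonneg.2 (by positivity)
  let f : ℤ × ℤ → ℤ := fun v => ⌊M * Int.fract ((v.1 : ℝ) * x₁ + v.2 * x₂)⌋
  have hmaps : ∀ v ∈ Finset.Icc 0 N₁ ×ˢ Finset.Icc 0 N₂, f v ∈ Finset.Ico 0 M := by
    intro v _
    have hf0 := Int.fract_nonneg ((v.1 : ℝ) * x₁ + v.2 * x₂)
    have hf1 := Int.fract_lt_one ((v.1 : ℝ) * x₁ + v.2 * x₂)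
    simp only [f, Finset.mem_Ico]
    refine ⟨Int.floor_nonneg.2 (by positivity), Int.floor_lt.2 ?_⟩
    nlinarith
  have hcard : (Finset.Ico 0 M).card < (Finset.Icc 0 N₁ ×ˢ Finset.Icc 0 N₂).card := by
    rw [Finset.card_product, Int.card_Ico, Int.card_Icc, Int.card_Icc]
    -- The factor `2 / a ^ 3` is chosen so that the two sides of the box multiply to `2 * T / a ^
    -- 2`, which bounds the number `M` of intervals.
    have h3 : (M : ℝ) < (N₁ + 1) * (N₂ + 1) := by
      calc (M : ℝ) ≤ 2 * (T ^ i * T ^ j) / a ^ 2 := by rw [hTT]; exact hMle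
        _ = (2 / a ^ 3 * T ^ i) * (a * T ^ j) := by field_simp
        _ < _ := by
          have := Int.lt_floor_add_one (2 / a ^ 3 * T ^ i)
          have := Int.lt_floor_add_one (a * T ^ j)
          gcongr
    have h4 : M < (N₁ + 1) * (N₂ + 1) := by exact_mod_cast h3
    have hM0' : 0 < M := by exact_mod_cast hM0
    zify
    rw [Int.toNat_of_nonneg (by lia), Int.toNat_of_nonneg (by lia), Int.toNat_of_nonneg (by lia)]
    linarith
  obtain ⟨v, hv, w, hw, hne, hf⟩ := Finset.exists_ne_map_eq_of_card_lt_of_maps_to hcard hmaps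
  simp only [Finset.mem_product, Finset.mem_Icc] at hv hw
  have bound : ∀ (p q N : ℤ) (r : ℝ), N = ⌊r⌋ → 0 ≤ p → p ≤ N → 0 ≤ q → q ≤ N →
      |((p - q : ℤ) : ℝ)| ≤ r := by
    intro p q N r hN hp hp' hq hq'
    have : |p - q| ≤ ⌊r⌋ := by rw [abs_le]; lia
    exact_mod_cast Int.le_floor.1 this
  refine ⟨v.1 - w.1, v.2 - w.2, ?_, bound _ _ _ _ hN₁ hv.1.1 hv.1.2 hw.1.1 hw.1.2,
    bound _ _ _ _ hN₂ hv.2.1 hv.2.2 hw.2.1 hw.2.2, ?_⟩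
  · by_contra! h
    exact hne (Prod.ext (by lia) (by lia))
  · refine (distNearestInt_le _
      (⌊(v.1 : ℝ) * x₁ + v.2 * x₂⌋ - ⌊(w.1 : ℝ) * x₁ + w.2 * x₂⌋)).trans_lt ?_
    have := Int.abs_sub_lt_one_of_floor_eq_floor hf
    rw [← mul_sub, abs_mul, abs_of_pos hM0] at this
    have e : ((v.1 - w.1 : ℤ) : ℝ) * x₁ + ((v.2 - w.2 : ℤ) : ℝ) * x₂ -
        ((⌊(v.1 : ℝ) * x₁ + v.2 * x₂⌋ - ⌊(w.1 : ℝ) * x₁ + w.2 * x₂⌋ : ℤ) : ℝ) =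
        Int.fract ((v.1 : ℝ) * x₁ + v.2 * x₂) - Int.fract ((w.1 : ℝ) * x₁ + w.2 * x₂) := by
      simp only [Int.fract]; push_cast; ring
    rw [e, lt_div_iff₀ hT0]
    rw [div_le_iff₀ (by positivity)] at hTM
    set D := |Int.fract ((v.1 : ℝ) * x₁ + v.2 * x₂) - Int.fract ((w.1 : ℝ) * x₁ + w.2 * x₂)|
    have hD : 0 ≤ D := abs_nonneg _
    calc D * T ≤ D * (M * a ^ 2) := by gcongr
      _ = (M * D) * a ^ 2 := by ring
      _ < 1 * a ^ 2 := by gcongr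
      _ = a ^ 2 := one_mul _

/-- At every scale `T` there is a linear form that is small at `(x₁, x₂)` and whose first
coefficient has the exact order of magnitude `T ^ i`. -/
theorem IsBadConstant.exists_linearForm {i j a T x₁ x₂ : ℝ}
    (hx : IsBadConstant (8 * a) i j x₁ x₂) (hi : 0 < i) (hj : 0 < j)
    (hij : i + j = 1) (ha : 0 < a) (ha1 : a ≤ 1) (hT : 1 ≤ T) :
    ∃ u₁ u₂ : ℤ, a * T ^ i ≤ |(u₁ : ℝ)| ∧ |(u₁ : ℝ)| ≤ 2 / a ^ 3 * T ^ i ∧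
      |(u₂ : ℝ)| ≤ a * T ^ j ∧ distNearestInt (u₁ * x₁ + u₂ * x₂) ≤ 1 / T := by
  obtain ⟨u₁, u₂, hu, h₁, h₂, h⟩ := exists_linearForm_lt x₁ x₂ hij ha ha1 hT
  refine ⟨u₁, u₂, ?_, h₁, h₂, h.le.trans ?_⟩
  · by_contra! hlt
    exact absurd h (not_lt.2 (hx.linearForm hi hj hij ha ha1 hT hu hlt.le h₂))
  · gcongr
    exact pow_le_one₀ ha.le ha1

/-! ### From linear forms back to inhomogeneous approximation. -/

/-- If every scale `R ^ k` has a linear form that is small at `(x₁, x₂)` and bounded away from the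
integers at `(y₁, y₂)`, then `(y₁, y₂)` is badly approximable by the multiples of `(x₁, x₂)`. -/
theorem exists_pos_le_max_of_linearForms {i j C R ε x₁ x₂ y₁ y₂ : ℝ} {u₁ u₂ : ℕ → ℤ}
    (hi : 0 < i) (hj : 0 < j) (hij : i + j = 1) (hC : 0 < C) (hR : 1 < R) (hε : 0 < ε)
    (h₁ : ∀ k, |(u₁ k : ℝ)| ≤ C * (R ^ k) ^ i) (h₂ : ∀ k, |(u₂ k : ℝ)| ≤ C * (R ^ k) ^ j)
    (h : ∀ k, distNearestInt (u₁ k * x₁ + u₂ k * x₂) ≤ 1 / R ^ k)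
    (hy : ∀ k, ε ≤ distNearestInt (u₁ k * y₁ + u₂ k * y₂)) :
    ∃ δ : ℝ, 0 < δ ∧ ∀ q : ℤ, q ≠ 0 → δ ≤ max (|(q : ℝ)| ^ i * distNearestInt (q * x₁ - y₁))
      (|(q : ℝ)| ^ j * distNearestInt (q * x₂ - y₂)) := by
  have hR0 : 0 < R := by linarith
  set K : ℝ := max 1 (2 * R / ε) with hK
  have hK1 : 1 ≤ K := le_max_left _ _
  refine ⟨ε / (4 * C * K), by positivity, fun q hq => ?_⟩
  have hq1 : (1 : ℝ) ≤ |(q : ℝ)| := by exact_mod_cast Int.one_le_abs hq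
  have hq0 : (0 : ℝ) < |(q : ℝ)| := by linarith
  -- The least `k` satisfying the first bound also satisfies the second: by minimality it overshoots
  -- by at most a factor `R`, unless `k = 0`, where `K ≥ 1` suffices.
  obtain ⟨k, hk, hk'⟩ : ∃ k : ℕ, 2 * |(q : ℝ)| / ε ≤ R ^ k ∧ R ^ k ≤ K * |(q : ℝ)| := by
    obtain ⟨n, hn⟩ := pow_unbounded_of_one_lt (2 * |(q : ℝ)| / ε) hR
    classical
    have hex : ∃ n : ℕ, 2 * |(q : ℝ)| / ε ≤ R ^ n := ⟨n, hn.le⟩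
    refine ⟨Nat.find hex, Nat.find_spec hex, ?_⟩
    rcases hm : Nat.find hex with _ | m
    · simp only [pow_zero]; nlinarith
    · have hlt : R ^ m < 2 * |(q : ℝ)| / ε := not_le.1 (Nat.find_min hex (by lia))
      calc R ^ (m + 1) = R * R ^ m := by ring
        _ ≤ R * (2 * |(q : ℝ)| / ε) := by gcongr
        _ = 2 * R / ε * |(q : ℝ)| := by ring
        _ ≤ K * |(q : ℝ)| := by gcongr; exact le_max_right _ _
  have hRk : 0 < R ^ k := by positivity
  have pw : ∀ e : ℝ, 0 < e → e ≤ 1 → (R ^ k) ^ e ≤ K * |(q : ℝ)| ^ e := by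
    intro e he he1
    calc (R ^ k) ^ e ≤ (K * |(q : ℝ)|) ^ e := by gcongr
      _ = K ^ e * |(q : ℝ)| ^ e := Real.mul_rpow (by linarith) hq0.le
      _ ≤ K ^ (1 : ℝ) * |(q : ℝ)| ^ e := by gcongr
      _ = _ := by rw [Real.rpow_one]
  set D₁ := distNearestInt (q * x₁ - y₁) with hD₁
  set D₂ := distNearestInt (q * x₂ - y₂) with hD₂
  have hD₁0 : 0 ≤ D₁ := distNearestInt_nonneg _
  have hD₂0 : 0 ≤ D₂ := distNearestInt_nonneg _
  have tri : ε ≤ |(q : ℝ)| * (1 / R ^ k) + |(u₁ k : ℝ)| * D₁ + |(u₂ k : ℝ)| * D₂ := by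
    set n₁ := round ((q : ℝ) * x₁ - y₁) with hn₁
    set n₂ := round ((q : ℝ) * x₂ - y₂) with hn₂
    set n₀ := round ((u₁ k : ℝ) * x₁ + u₂ k * x₂) with hn₀
    have e : (u₁ k : ℝ) * y₁ + u₂ k * y₂ - ((q * n₀ - u₁ k * n₁ - u₂ k * n₂ : ℤ) : ℝ) =
        q * (u₁ k * x₁ + u₂ k * x₂ - n₀) - u₁ k * (q * x₁ - y₁ - n₁)
          - u₂ k * (q * x₂ - y₂ - n₂) := by push_cast; ring
    calc ε ≤ _ := hy k
      _ ≤ _ := distNearestInt_le _ (q * n₀ - u₁ k * n₁ - u₂ k * n₂)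
      _ ≤ |(q : ℝ) * (u₁ k * x₁ + u₂ k * x₂ - n₀)| + |(u₁ k : ℝ) * (q * x₁ - y₁ - n₁)|
          + |(u₂ k : ℝ) * (q * x₂ - y₂ - n₂)| := by
        rw [e]
        exact (abs_sub _ _).trans (by gcongr; exact abs_sub _ _)
      _ ≤ _ := by
        rw [abs_mul, abs_mul, abs_mul]
        gcongr
        · exact h k
        · exact le_rfl
        · exact le_rfl
  have hhalf : |(q : ℝ)| * (1 / R ^ k) ≤ ε / 2 := by
    rw [mul_one_div, div_le_iff₀ hRk]
    rw [div_le_iff₀ hε] at hk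
    linarith
  have t₁ : |(u₁ k : ℝ)| * D₁ ≤ C * K * (|(q : ℝ)| ^ i * D₁) := by
    calc _ ≤ C * (K * |(q : ℝ)| ^ i) * D₁ := by
          gcongr
          exact (h₁ k).trans (by gcongr; exact pw i hi (by linarith))
      _ = _ := by ring
  have t₂ : |(u₂ k : ℝ)| * D₂ ≤ C * K * (|(q : ℝ)| ^ j * D₂) := by
    calc _ ≤ C * (K * |(q : ℝ)| ^ j) * D₂ := by
          gcongr
          exact (h₂ k).trans (by gcongr; exact pw j hj (by linarith))
      _ = _ := by ring
  have hCK : 0 < C * K := by positivity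
  have m₁ := mul_le_mul_of_nonneg_left
    (le_max_left (|(q : ℝ)| ^ i * D₁) (|(q : ℝ)| ^ j * D₂)) hCK.le
  have m₂ := mul_le_mul_of_nonneg_left
    (le_max_right (|(q : ℝ)| ^ i * D₁) (|(q : ℝ)| ^ j * D₂)) hCK.le
  rw [div_le_iff₀ (by positivity)]
  linarith

/-! ### Escaping from integers, and Alice's strategy. -/

/-- Moving away from the nearest integer gains distance from it, while the next integer ahead was at
least `1 / 2` away and so remains at least `1 / 4` away. -/
theorem min_le_distNearestInt_of_le_sub {t t₀ ε : ℝ} (h0 : (round t₀ : ℝ) ≤ t₀)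
    (h₁ : ε ≤ t - t₀) (h₂ : t - t₀ ≤ 1 / 4) : min ε (1 / 4) ≤ distNearestInt t := by
  have hr := (abs_le.1 (abs_sub_round t₀)).2
  rw [distNearestInt]
  rcases le_or_gt (round t) (round t₀) with h | h
  · have h' : (round t : ℝ) ≤ round t₀ := by exact_mod_cast h
    exact (min_le_left _ _).trans (le_trans (by linarith) (le_abs_self _))
  · have h' : (round t₀ : ℝ) + 1 ≤ round t := by exact_mod_cast h
    exact (min_le_right _ _).trans (le_trans (by linarith) (neg_le_abs _))

theorem min_le_distNearestInt_of_le_sub' {t t₀ ε : ℝ} (h0 : t₀ ≤ (round t₀ : ℝ))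
    (h₁ : ε ≤ t₀ - t) (h₂ : t₀ - t ≤ 1 / 4) : min ε (1 / 4) ≤ distNearestInt t := by
  have hr := (abs_le.1 (abs_sub_round t₀)).1
  rw [distNearestInt]
  rcases le_or_gt (round t₀) (round t) with h | h
  · have h' : (round t₀ : ℝ) ≤ round t := by exact_mod_cast h
    exact (min_le_left _ _).trans (le_trans (by linarith) (neg_le_abs _))
  · have h' : (round t : ℝ) + 1 ≤ round t₀ := by exact_mod_cast h
    exact (min_le_right _ _).trans (le_trans (by linarith) (le_abs_self _))

/-- The point of the inner ball farthest from `a`, on the ray from `a` through `b`, attains the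
bound. This turns Bob's set inclusions into inequalities between centres. -/
theorem dist_add_le_of_closedBall_subset {E : Type*} [NormedAddCommGroup E] [NormedSpace ℝ E]
    {a b : E} {r s : ℝ} (hr : 0 ≤ r) (hrs : r ≤ s)
    (h : Metric.closedBall b r ⊆ Metric.closedBall a s) : dist b a + r ≤ s := by
  rcases eq_or_ne b a with rfl | hne
  · simpa using hrs
  have hd : 0 < ‖b - a‖ := norm_pos_iff.2 (sub_ne_zero.2 hne)
  have hmem : b + (r / ‖b - a‖) • (b - a) ∈ Metric.closedBall b r := by
    rw [Metric.mem_closedBall, dist_eq_norm, add_sub_cancel_left, norm_smul, Real.norm_eq_abs,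
      abs_of_nonneg (by positivity)]
    field_simp
    exact le_rfl
  have := h hmem
  rw [Metric.mem_closedBall, dist_eq_norm,
    show b + (r / ‖b - a‖) • (b - a) - a = (1 + r / ‖b - a‖) • (b - a) by module,
    norm_smul, Real.norm_eq_abs, abs_of_nonneg (by positivity)] at this
  rw [dist_eq_norm]
  calc ‖b - a‖ + r = (1 + r / ‖b - a‖) * ‖b - a‖ := by field_simp
    _ ≤ s := this

section Game

variable {E : Type*} [NormedAddCommGroup E] [InnerProductSpace ℝ E]

/-- The unit vector `±u / ‖u‖` along which the linear form `u` moves away from the integer that is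
nearest to its value at `y`. -/
noncomputable def escapeDirection (u y : E) : E :=
  (if (round (inner ℝ u y) : ℝ) ≤ inner ℝ u y then ‖u‖⁻¹ else -‖u‖⁻¹) • u

theorem norm_escapeDirection {u : E} (hu : u ≠ 0) (y : E) : ‖escapeDirection u y‖ = 1 := by
  have : ‖u‖ ≠ 0 := norm_ne_zero_iff.2 hu
  rw [escapeDirection]
  split_ifs <;> simp [norm_smul, this]

theorem min_le_distNearestInt_inner {u y z : E} (hu : u ≠ 0) {ε : ℝ}
    (h₁ : ε ≤ ‖u‖ * inner ℝ (escapeDirection u y) (z - y)) (h₂ : ‖u‖ * ‖z - y‖ ≤ 1 / 4) :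
    min ε (1 / 4) ≤ distNearestInt (inner ℝ u z) := by
  have hu' : ‖u‖ ≠ 0 := norm_ne_zero_iff.2 hu
  have hcs := abs_le.1 ((abs_real_inner_le_norm u (z - y)).trans h₂)
  have e : (inner ℝ u (z - y) : ℝ) = inner ℝ u z - inner ℝ u y := inner_sub_right _ _ _
  rw [e] at hcs
  rw [escapeDirection, real_inner_smul_left, e] at h₁
  split_ifs at h₁ with h
  · rw [mul_inv_cancel_left₀ hu'] at h₁
    exact min_le_distNearestInt_of_le_sub h h₁ hcs.2
  · rw [neg_mul, mul_neg, mul_inv_cancel_left₀ hu'] at h₁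
    exact min_le_distNearestInt_of_le_sub' (not_le.1 h).le (by linarith) (by linarith)

/-- One round of the game: if Alice moves along the unit vector `w` as far as she can, then Bob's
next centre has moved in the direction `w` by at least the radius of his next ball. -/
theorem le_inner_sub_of_dist_le {w b b' : E} {r r' : ℝ} (hw : ‖w‖ = 1)
    (h : dist b' (b + (r / 2) • w) + r' ≤ r / 2) : r' ≤ inner ℝ w (b' - b) := by
  have e : b' - b = (b' - (b + (r / 2) • w)) + (r / 2) • w := by module
  have hcs := (abs_le.1 (abs_real_inner_le_norm w (b' - (b + (r / 2) • w)))).1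
  rw [hw, one_mul, ← dist_eq_norm] at hcs
  rw [e, inner_add_right, real_inner_smul_right, real_inner_self_eq_norm_sq, hw]
  linarith

theorem exists_iInter_closedBall_eq_singleton {X : Type*} [MetricSpace X] [ProperSpace X]
    {b : ℕ → X} {r : ℕ → ℝ} (hr : ∀ n, 0 ≤ r n)
    (hr0 : Filter.Tendsto r Filter.atTop (nhds 0))
    (h : ∀ n, Metric.closedBall (b (n + 1)) (r (n + 1)) ⊆ Metric.closedBall (b n) (r n)) :
    ∃ y, ⋂ n, Metric.closedBall (b n) (r n) = {y} := by
  obtain ⟨y, hy⟩ := IsCompact.nonempty_iInter_of_sequence_nonempty_isCompact_isClosed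
    (fun n => Metric.closedBall (b n) (r n)) h (fun n => ⟨b n, Metric.mem_closedBall_self (hr n)⟩)
    (isCompact_closedBall _ _) (fun n => Metric.isClosed_closedBall)
  refine ⟨y, Set.Subset.antisymm (fun z hz => ?_) (Set.singleton_subset_iff.2 hy)⟩
  rw [Set.mem_iInter] at hy hz
  have hle : ∀ n, dist z y ≤ r n + r n := fun n =>
    (dist_triangle_right z y (b n)).trans (add_le_add (hz n) (hy n))
  have := ge_of_tendsto' (hr0.add hr0) hle
  rw [add_zero] at this
  exact dist_le_zero.1 this

/-- The points at which a suitably lacunary sequence of linear forms stays away from the integers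
form a winning set for the `(1/2, β)`-game. -/
theorem isSchmidtWinningPair_half_of_lacunary [ProperSpace E] {S : Set E} {β c C : ℝ}
    (hβ0 : 0 < β) (hβ1 : β < 1) (hc : 0 < c) {u : ℕ → E}
    (hcu : ∀ k, c ≤ ‖u k‖ * (1 / 2 * β) ^ (2 * k)) (huC : ∀ k, ‖u k‖ * (1 / 2 * β) ^ (2 * k) ≤ C)
    (hS : ∀ y, ∀ ε > 0, (∀ k, ε ≤ distNearestInt (inner ℝ (u k) y)) → y ∈ S) :
    IsSchmidtWinningPair (1 / 2) β S := by
  unfold IsSchmidtWinningPair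
  set g := 1 / 2 * β with hg
  have hg0 : 0 < g := by positivity
  have hg1 : g < 1 / 2 := by linarith
  have hpow : Filter.Tendsto (fun n : ℕ => g ^ n) Filter.atTop (nhds 0) :=
    tendsto_pow_atTop_nhds_zero_of_lt_one hg0.le (by linarith)
  have hu0 : ∀ k, u k ≠ 0 := by
    intro k hk
    have := hcu k
    rw [hk, norm_zero, zero_mul] at this
    linarith
  -- Alice waits `2 * s` rounds, until Bob's ball is so small that the form treated next varies by
  -- at most `1 / 4` from its value at the centre.
  have hshift : ∀ ρ : ℝ, ∃ s : ℕ, C * ρ * g ^ (2 * s) ≤ 1 / 4 := by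
    intro ρ
    have h2 : Filter.Tendsto (fun s : ℕ => C * ρ * g ^ (2 * s)) Filter.atTop (nhds (C * ρ * 0)) :=
      (hpow.comp (Filter.tendsto_id.const_mul_atTop' two_pos)).const_mul _
    rw [mul_zero] at h2
    exact (h2.eventually (eventually_le_nhds (by norm_num))).exists
  choose s hs using hshift
  -- The current round is `l.length - 1`. Rounds `2 * m` and `2 * m + 1` share the direction
  -- computed from the centre `b (2 * m)`. During the waiting rounds the truncated subtraction
  -- selects `u 0`, which is harmless.
  refine ⟨fun ρ l => l.getD (l.length - 1) 0 + (g ^ (l.length - 1) * ρ / 2) •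
    escapeDirection (u ((l.length - 1) / 2 - s ρ)) (l.getD (2 * ((l.length - 1) / 2)) 0), ?_⟩
  intro ρ hρ a b ha hb
  have hr0 : ∀ n, 0 < g ^ n * ρ := fun n => by positivity
  have hr1 : ∀ n, g ^ (n + 1) * ρ ≤ g ^ n * ρ / 2 := fun n => by
    have := hr0 n
    rw [pow_succ]
    nlinarith
  have ha' : ∀ n, a n = b n + (g ^ n * ρ / 2) •
      escapeDirection (u (n / 2 - s ρ)) (b (2 * (n / 2))) := by
    intro n
    have h2 : 2 * (n / 2) < n + 1 := by lia
    rw [ha n]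
    simp [List.getD_eq_getElem?_getD, h2]
  have halice : ∀ n, Metric.closedBall (a n) (1 / 2 * (g ^ n * ρ)) ⊆
      Metric.closedBall (b n) (g ^ n * ρ) := by
    intro n
    apply Metric.closedBall_subset_closedBall'
    have := hr0 n
    rw [ha' n, dist_eq_norm, add_sub_cancel_left, norm_smul, norm_escapeDirection (hu0 _),
      Real.norm_eq_abs, abs_of_pos (by linarith)]
    linarith
  have hbob : ∀ n, dist (b (n + 1)) (a n) + g ^ (n + 1) * ρ ≤ g ^ n * ρ / 2 := by
    intro n
    have := dist_add_le_of_closedBall_subset (hr0 (n + 1)).le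
      (by linarith [hr1 n]) (hb n)
    linarith
  refine ⟨halice, ?_⟩
  obtain ⟨y, hy⟩ := exists_iInter_closedBall_eq_singleton (b := b) (fun n => (hr0 n).le)
    (by simpa using hpow.mul_const ρ) (fun n => (hb n).trans (halice n))
  refine ⟨y, hS y (min (c * (g ^ (2 * s ρ + 1) * ρ)) (1 / 4)) (by positivity) fun k => ?_, hy⟩
  have hmem : ∀ n, ‖y - b n‖ ≤ g ^ n * ρ := by
    intro n
    have : y ∈ ⋂ n, Metric.closedBall (b n) (g ^ n * ρ) := by rw [hy]; rfl
    simpa [dist_eq_norm] using Set.mem_iInter.1 this n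
  set n := 2 * (k + s ρ) with hn
  set w := escapeDirection (u k) (b n) with hw
  have hw1 : ‖w‖ = 1 := norm_escapeDirection (hu0 k) _
  have s₁ : g ^ (n + 1) * ρ ≤ inner ℝ w (b (n + 1) - b n) := by
    have := hbob n
    rw [ha' n, show n / 2 - s ρ = k by lia, show 2 * (n / 2) = n by lia] at this
    exact le_inner_sub_of_dist_le hw1 this
  have s₂ : g ^ (n + 2) * ρ ≤ inner ℝ w (b (n + 2) - b (n + 1)) := by
    have := hbob (n + 1)
    rw [ha' (n + 1), show (n + 1) / 2 - s ρ = k by lia,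
      show 2 * ((n + 1) / 2) = n by lia] at this
    exact le_inner_sub_of_dist_le hw1 this
  -- The limit point may lie a full radius behind Bob's last centre. This cancels the gain of the
  -- second round and leaves that of the first, hence two rounds per form.
  have s₃ : -(g ^ (n + 2) * ρ) ≤ inner ℝ w (y - b (n + 2)) := by
    have h := (abs_le.1 (abs_real_inner_le_norm w (y - b (n + 2)))).1
    rw [hw1, one_mul] at h
    linarith [hmem (n + 2)]
  have hsum : g ^ (n + 1) * ρ ≤ inner ℝ w (y - b n) := by
    rw [show y - b n = (y - b (n + 2)) + (b (n + 2) - b (n + 1)) + (b (n + 1) - b n) by abel,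
      inner_add_right, inner_add_right]
    linarith
  refine min_le_distNearestInt_inner (y := b n) (hu0 k) ?_ ?_
  · calc c * (g ^ (2 * s ρ + 1) * ρ) ≤ ‖u k‖ * g ^ (2 * k) * (g ^ (2 * s ρ + 1) * ρ) := by
          gcongr; exact hcu k
      _ = ‖u k‖ * (g ^ (n + 1) * ρ) := by rw [hn]; ring
      _ ≤ _ := by gcongr
  · calc ‖u k‖ * ‖y - b n‖ ≤ ‖u k‖ * (g ^ n * ρ) := by gcongr; exact hmem n
      _ = ‖u k‖ * g ^ (2 * k) * (ρ * g ^ (2 * s ρ)) := by rw [hn]; ring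
      _ ≤ C * (ρ * g ^ (2 * s ρ)) := by gcongr; exact huC k
      _ ≤ 1 / 4 := by rw [← mul_assoc]; exact hs ρ

end Game

/-! ### Assembling the proof. -/

theorem exists_isBadConstant {i j : ℝ} {x : EuclideanSpace ℝ (Fin 2)} (hx : x ∈ Bad i j) :
    ∃ a : ℝ, 0 < a ∧ a ≤ 1 ∧ IsBadConstant (8 * a) i j (x 0) (x 1) := by
  obtain ⟨-, h⟩ := hx
  set c := ⨅ q : {q : ℤ // q ≠ 0}, max (|(q.1 : ℝ)| ^ i * distNearestInt ((q.1 : ℝ) * x 0))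
    (|(q.1 : ℝ)| ^ j * distNearestInt ((q.1 : ℝ) * x 1)) with hc
  refine ⟨min (c / 8) 1, by positivity, min_le_right _ _, fun q hq => ?_⟩
  have hle : c ≤ max (|(q : ℝ)| ^ i * distNearestInt (q * x 0))
      (|(q : ℝ)| ^ j * distNearestInt (q * x 1)) := by
    refine ciInf_le ⟨0, ?_⟩ (⟨q, hq⟩ : {q : ℤ // q ≠ 0})
    rintro _ ⟨p, rfl⟩
    exact le_max_of_le_left (mul_nonneg (by positivity) (distNearestInt_nonneg _))
  have := min_le_left (c / 8) 1
  linarith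

theorem mem_periodicExtension_twistedBad {i j δ : ℝ} {x y : EuclideanSpace ℝ (Fin 2)}
    (hδ : 0 < δ)
    (h : ∀ q : ℤ, q ≠ 0 → δ ≤ max (|(q : ℝ)| ^ i * distNearestInt (q * x 0 - y 0))
      (|(q : ℝ)| ^ j * distNearestInt (q * x 1 - y 1))) :
    y ∈ periodicExtension (TwistedBad x i j) := by
  have e : ∀ s t : ℝ, distNearestInt (s - Int.fract t) = distNearestInt (s - t) := by
    intro s t
    rw [← distNearestInt_add_intCast (s - t) ⌊t⌋, Int.fract]
    congr 1
    ring
  refine ⟨fun k => ?_, hδ.trans_le ?_⟩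
  · fin_cases k
    · exact ⟨Int.fract_nonneg _, Int.fract_lt_one _⟩
    · exact ⟨Int.fract_nonneg _, Int.fract_lt_one _⟩
  · have : Nonempty {q : ℤ // q ≠ 0} := ⟨⟨1, one_ne_zero⟩⟩
    refine le_ciInf fun q => ?_
    simpa [e] using h q.1 q.2

/-- A geometric sequence of scales whose linear forms are small at `(x₁, x₂)`, and whose dominant
coefficients grow like `θ⁻ᵏ`. -/
theorem IsBadConstant.exists_lacunary {i j a θ x₁ x₂ : ℝ}
    (hx : IsBadConstant (8 * a) i j x₁ x₂) (hi : 0 < i) (hj : 0 < j) (hji : j ≤ i)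
    (hij : i + j = 1) (ha : 0 < a) (ha1 : a ≤ 1) (hθ0 : 0 < θ) (hθ1 : θ < 1) :
    ∃ (R : ℝ) (u₁ u₂ : ℕ → ℤ), 1 < R ∧
      (∀ k, |(u₁ k : ℝ)| ≤ 2 / a ^ 3 * (R ^ k) ^ i) ∧
      (∀ k, |(u₂ k : ℝ)| ≤ 2 / a ^ 3 * (R ^ k) ^ j) ∧
      (∀ k, distNearestInt (u₁ k * x₁ + u₂ k * x₂) ≤ 1 / R ^ k) ∧
      (∀ k, a ≤ |(u₁ k : ℝ)| * θ ^ k) ∧ (∀ k, |(u₁ k : ℝ)| * θ ^ k ≤ 2 / a ^ 3) ∧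
      (∀ k, |(u₂ k : ℝ)| * θ ^ k ≤ 2 / a ^ 3) := by
  -- With this choice `R ^ i = θ⁻¹`, so the dominant coefficients grow at exactly the rate at which
  -- Bob's radii shrink over two rounds when `θ = (1 / 2 * β) ^ 2`.
  set R := θ⁻¹ ^ i⁻¹ with hR
  have hR1 : 1 < R := Real.one_lt_rpow ((one_lt_inv₀ hθ0).2 hθ1) (by positivity)
  have hRk : ∀ k : ℕ, 1 ≤ R ^ k := fun k => one_le_pow₀ hR1.le
  have hRi : ∀ k : ℕ, (R ^ k) ^ i * θ ^ k = 1 := by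
    intro k
    have hRθ : R ^ i = θ⁻¹ := Real.rpow_inv_rpow (by positivity) hi.ne'
    rw [← Real.rpow_pow_comm (by positivity), hRθ, ← mul_pow, inv_mul_cancel₀ hθ0.ne', one_pow]
  have hRj : ∀ k : ℕ, (R ^ k) ^ j * θ ^ k ≤ 1 := by
    intro k
    rw [← hRi k]
    gcongr
    exact hRk k
  have haC : a ≤ 2 / a ^ 3 := by
    rw [le_div_iff₀ (by positivity)]
    have : a ^ 4 ≤ 1 := pow_le_one₀ ha.le ha1
    nlinarith
  choose u₁ u₂ h₁ h₂ h₃ h₄ using fun k : ℕ => hx.exists_linearForm hi hj hij ha ha1 (hRk k)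
  have h₃' : ∀ k, |(u₂ k : ℝ)| ≤ 2 / a ^ 3 * (R ^ k) ^ j := fun k =>
    (h₃ k).trans (by gcongr)
  refine ⟨R, u₁, u₂, hR1, h₂, h₃', h₄, fun k => ?_, fun k => ?_, fun k => ?_⟩
  · calc a = a * (R ^ k) ^ i * θ ^ k := by rw [mul_assoc, hRi, mul_one]
      _ ≤ _ := by gcongr; exact h₁ k
  · calc |(u₁ k : ℝ)| * θ ^ k ≤ 2 / a ^ 3 * (R ^ k) ^ i * θ ^ k := by gcongr; exact h₂ k
      _ = 2 / a ^ 3 := by rw [mul_assoc, hRi, mul_one]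
  · calc |(u₂ k : ℝ)| * θ ^ k ≤ 2 / a ^ 3 * (R ^ k) ^ j * θ ^ k := by gcongr; exact h₃' k
      _ ≤ 2 / a ^ 3 * 1 := by rw [mul_assoc]; gcongr; exact hRj k
      _ = 2 / a ^ 3 := mul_one _

theorem EuclideanSpace.norm_le_abs_add_abs (v : EuclideanSpace ℝ (Fin 2)) :
    ‖v‖ ≤ |v 0| + |v 1| := by
  rw [EuclideanSpace.norm_eq, Fin.sum_univ_two, Real.norm_eq_abs, Real.norm_eq_abs]
  refine Real.sqrt_le_iff.2 ⟨by positivity, ?_⟩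
  nlinarith [abs_nonneg (v 0), abs_nonneg (v 1)]

/-- The winning property follows from linear forms one of whose coefficients dominates. -/
theorem isSchmidtWinningPair_of_linearForms {i j C R a β : ℝ} {u₁ u₂ : ℕ → ℤ}
    {x : EuclideanSpace ℝ (Fin 2)} (hi : 0 < i) (hj : 0 < j) (hij : i + j = 1) (hC : 0 < C)
    (hR : 1 < R) (ha : 0 < a) (hβ0 : 0 < β) (hβ1 : β < 1)
    (h₁ : ∀ k, |(u₁ k : ℝ)| ≤ C * (R ^ k) ^ i) (h₂ : ∀ k, |(u₂ k : ℝ)| ≤ C * (R ^ k) ^ j)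
    (h : ∀ k, distNearestInt (u₁ k * x 0 + u₂ k * x 1) ≤ 1 / R ^ k)
    (hl : ∀ k, a ≤ max |(u₁ k : ℝ)| |(u₂ k : ℝ)| * ((1 / 2 * β) ^ 2) ^ k)
    (hu₁ : ∀ k, |(u₁ k : ℝ)| * ((1 / 2 * β) ^ 2) ^ k ≤ C)
    (hu₂ : ∀ k, |(u₂ k : ℝ)| * ((1 / 2 * β) ^ 2) ^ k ≤ C) :
    IsSchmidtWinningPair (1 / 2) β (periodicExtension (TwistedBad x i j)) := by
  refine isSchmidtWinningPair_half_of_lacunary (c := a) (C := C + C)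
    (u := fun k => !₂[(u₁ k : ℝ), (u₂ k : ℝ)]) hβ0 hβ1 ha (fun k => ?_) (fun k => ?_)
    fun y ε hε hy => ?_
  · rw [pow_mul]
    refine (hl k).trans ?_
    gcongr
    refine max_le ?_ ?_
    · simpa using PiLp.norm_apply_le (!₂[(u₁ k : ℝ), (u₂ k : ℝ)]) 0
    · simpa using PiLp.norm_apply_le (!₂[(u₁ k : ℝ), (u₂ k : ℝ)]) 1
  · rw [pow_mul]
    have := EuclideanSpace.norm_le_abs_add_abs !₂[(u₁ k : ℝ), (u₂ k : ℝ)]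
    calc _ ≤ (|(u₁ k : ℝ)| + |(u₂ k : ℝ)|) * ((1 / 2 * β) ^ 2) ^ k := by
          gcongr; simpa using this
      _ ≤ C + C := by rw [add_mul]; exact add_le_add (hu₁ k) (hu₂ k)
  · obtain ⟨δ, hδ, hq⟩ := exists_pos_le_max_of_linearForms (y₁ := y 0) (y₂ := y 1)
      hi hj hij hC hR hε h₁ h₂ h fun k => by
        simpa [PiLp.inner_apply, Fin.sum_univ_two, mul_comm] using hy k
    exact mem_periodicExtension_twistedBad hδ hq

theorem mainTheorem3 (i j : ℝ) (hi : 0 < i) (hj : 0 < j) (hij : i + j = 1)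
    (x : EuclideanSpace ℝ (Fin 2)) (hx : x ∈ Bad i j) :
    IsSchmidtWinning (1 / 2) (periodicExtension (TwistedBad x i j)) := by
  intro β hβ0 hβ1
  obtain ⟨a, ha, ha1, hbad⟩ := exists_isBadConstant hx
  have hθ0 : 0 < (1 / 2 * β) ^ 2 := by positivity
  have hθ1 : (1 / 2 * β) ^ 2 < 1 := pow_lt_one₀ (by positivity) (by linarith) two_ne_zero
  -- The larger weight decides which coefficient dominates; the second case exchanges the
  -- coordinates.
  rcases le_total j i with hji | hji
  · obtain ⟨R, u₁, u₂, hR, h₁, h₂, h, hl, hu₁, hu₂⟩ :=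
      hbad.exists_lacunary hi hj hji hij ha ha1 hθ0 hθ1
    refine isSchmidtWinningPair_of_linearForms hi hj hij (by positivity) hR ha hβ0 hβ1 h₁ h₂ h
      (fun k => (hl k).trans ?_) hu₁ hu₂
    gcongr
    exact le_max_left _ _
  · obtain ⟨R, u₂, u₁, hR, h₂, h₁, h, hl, hu₂, hu₁⟩ :=
      hbad.swap.exists_lacunary hj hi hji (by linarith) ha ha1 hθ0 hθ1
    refine isSchmidtWinningPair_of_linearForms hi hj hij (by positivity) hR ha hβ0 hβ1 h₁ h₂
      (fun k => by rw [add_comm]; exact h k) (fun k => (hl k).trans ?_) hu₁ hu₂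
    gcongr
    exact le_max_right _ _
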